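/- Let $\mathcal X_+$ be the class of all nonnegative random variables $X$ (on arbitrary probability spaces) with $\mathsf E X<\infty$. For $X\in\mathcal X_+$ let $m_X\in[0,\infty)$ and $M_X\in[0,\infty]$ be the infimum and the supremum of the support of the distribution of $X$, and put $$V_X=\operatorname{Var}\sqrt X,\quad E_X=\mathsf E(\sqrt X-\sqrt{m_X})^2,\quad F_X=\mathsf E(\sqrt{M_X}-\sqrt X)^2,\quad D_X=\mathsf E X-\exp\mathsf E\ln X,$$ where $F_X=\infty$ if $M_X=\infty$, and $\ln 0=-\infty$, $\exp(-\infty)=0$. For $V,E\in\mathbb R$ and $F\in(-\infty,\infty]$ let $\mathcal X_{\mathrm{hi};V,E}=\{X\in\mathcal X_+\colon V_X=V,\ E_X=E\}$ and $\mathcal X_{\mathrm{lo};V,F}=\{X\in\mathcal X_+\colon V_X=V,\ F_X=F\}$. Read $\frac{FV}{F-V}$ as $V$ if $F=\infty$ and as $0$ if $F=V$; $\vee$ and $\wedge$ denote maximum and minimum. Then: (i) If $\mathcal X_{\mathrm{hi};V,E}\neq\emptyset$, then $\sup\{D_X\colon X\in\mathcal X_{\mathrm{hi};V,E}\}=(2V)\vee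 E$, and the supremum over only those $X\in\mathcal X_{\mathrm{hi};V,E}$ that take at most two values has the same value. (ii) If $\mathcal X_{\mathrm{lo};V,F}\neq\emptyset$, then $\inf\{D_X\colon X\in\mathcal X_{\mathrm{lo};V,F}\}=(2V)\wedge\frac{FV}{F-V}$, and if moreover $F<\infty$, the infimum over only those $X\in\mathcal X_{\mathrm{lo};V,F}$ that take at most two values has the same value. (iii) Consequently, for every $X\in\mathcal X_+$, $$(2V_X)\wedge\frac{F_XV_X}{F_X-V_X}\ \le\ \mathsf E X-\exp\mathsf E\ln X\ \le\ (2V_X)\vee E_X .$$ -/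

import Mathlib

open MeasureTheory ProbabilityTheory Set
open scoped ENNReal

universe u

noncomputable section

/-- A nonnegative real random variable `X` with `E X < ∞`, on an arbitrary probability space. -/
structure NonnegRV : Type (u + 1) where
  /-- the sample space -/
  Ω : Type u
  [mΩ : MeasurableSpace Ω]
  /-- the probability measure -/
  P : Measure Ω
  [isProb : IsProbabilityMeasure P]
  /-- the random variable -/
  X : Ω → ℝ
  measurable_X : Measurable X
  nonneg_X : ∀ ω, 0 ≤ X ω
  integrable_X : Integrable X P

attribute [instance] NonnegRV.mΩ NonnegRV.isProb

/-- The expectation `E f⁺ - E f⁻` of an extended-real function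
(meaningful when one of the two terms is finite). -/
def eexpect {Ω : Type u} [MeasurableSpace Ω] (P : Measure Ω) (f : Ω → EReal) : EReal :=
  ((∫⁻ ω, (f ω).toENNReal ∂P : ℝ≥0∞) : EReal) - ((∫⁻ ω, (-f ω).toENNReal ∂P : ℝ≥0∞) : EReal)

namespace NonnegRV

/-- The support of the distribution of `X`. -/
def supp (R : NonnegRV.{u}) : Set ℝ := (R.P.map R.X).support

/-- `V_X = Var √X`. -/
def V (R : NonnegRV.{u}) : ℝ := variance (fun ω => √(R.X ω)) R.P

/-- `m_X = inf supp X`; the support is nonempty and contained in `[0, ∞)`. -/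
def m (R : NonnegRV.{u}) : ℝ := sInf R.supp

/-- `M_X = sup supp X`, possibly `∞`. -/
def M (R : NonnegRV.{u}) : EReal := ⨆ x ∈ R.supp, (x : EReal)

/-- `E_X = E (√X - √m_X)²`. -/
def E (R : NonnegRV.{u}) : ℝ := ∫ ω, (√(R.X ω) - √R.m) ^ 2 ∂(R.P)

open Classical in
/-- `F_X = E (√M_X - √X)²`, which is `∞` if `M_X = ∞`. -/
def F (R : NonnegRV.{u}) : EReal :=
  if R.M = ⊤ then ⊤ else ((∫ ω, (√R.M.toReal - √(R.X ω)) ^ 2 ∂(R.P) : ℝ) : EReal)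

/-- `E ln X`, an element of `[-∞, ∞)`, with `ln 0 = -∞`. -/
def expectLog (R : NonnegRV.{u}) : EReal :=
  eexpect R.P fun ω => ENNReal.log (ENNReal.ofReal (R.X ω))

/-- `D_X = E X - exp E ln X`, with `exp (-∞) = 0`. -/
def D (R : NonnegRV.{u}) : ℝ := (∫ ω, R.X ω ∂(R.P)) - (EReal.exp R.expectLog).toReal

/-- `X` takes at most two values. -/
def AtMostTwoValues (R : NonnegRV.{u}) : Prop := (range R.X).encard ≤ 2

end NonnegRV

/-- The `X` with `V_X = V` and `E_X = E`. -/
def XHi (V E : ℝ) : Set NonnegRV.{u} := {R | R.V = V ∧ R.E = E}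

/-- The `X` with `V_X = V` and `F_X = F`. -/
def XLo (V : ℝ) (F : EReal) : Set NonnegRV.{u} := {R | R.V = V ∧ R.F = F}

open Classical in
/-- `F V / (F - V)`, understood as `V` if `F = ∞` and as `0` if `F = V`. -/
def ratioFV (V : ℝ) (F : EReal) : ℝ :=
  if F = ⊤ then V else if F = (V : EReal) then 0 else F.toReal * V / (F.toReal - V)

end

/-!
Write `Y = √X`. Everything is expressed through `V = Var Y` and the first two moments of
`Z = Y - a`, where `a` is the left or the right end of the range of `Y`; the only nontrivial
quantity is the geometric mean `exp E ln X`.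

*Reduction to two points.* The function `w ↦ log (1 + w) / w` is convex, hence lies above its
tangent line at the point `v` (`exists_log_one_add_tangent`). Multiplying by `w` gives a quadratic
bound for `log (1 + w)`, from below for `w ≥ 0` and from above for `w ≤ 0`. For `w = Z / a` and
`v = E Z² / (a E Z)`, the correction term `w (w - v)` has mean zero, so that `exp E ln X` is
bounded by its value for the two-point distribution of `Y` with one atom at `a` and with the same
first two moments: from below if `a` is the left end (`twoPoint_le_geo`), from above if it is the
right end (`geo_le_twoPoint`).

*Two points.* If `Y` is `a (1 + u)` with probability `p` and `a` otherwise, then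
`D_X = a² (1 + 2pu + pu² - (1 + u)^(2p))`. Depending on whether `2p ≤ 1`, Bernoulli's inequality
of the second or of the first order bounds this by one of the two expressions in the maximum or
minimum (`twoPoint_gap_le`, `le_twoPoint_gap`). This proves the inequalities `D_le` and `le_D`.

*Sharpness.* Fixing `V` and `E` (or `F`) fixes `p` and the distance between the two atoms of `Y`,
but not their position. With the smaller atom at `0` the geometric mean vanishes and `D_X` is
`E`, respectively `F V / (F - V)`; when the atoms move off to infinity, `D_X` tends to `2 V`
(`tendsto_twoPoint_gap`). If `F = ∞`, an unbounded `X` is mixed with an atom at `0` of weight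
tending to `1`, rescaled so as to keep `V` (`le_V_of_forall_unbounded`).
-/

/-! ### Inequalities for the logarithm and for powers -/

lemma mul_integral_inv_one_add_mul {w : ℝ} (hw : -1 < w) :
    w * ∫ s in (0 : ℝ)..1, (1 + s * w)⁻¹ = Real.log (1 + w) := by
  have hpos : ∀ s ∈ Icc (0 : ℝ) 1, 0 < 1 + s * w := by
    intro s hs
    rcases le_total 0 w with h | h <;> nlinarith [hs.1, hs.2]
  have hcont : ContinuousOn (fun s : ℝ => (1 + s * w)⁻¹) (uIcc 0 1) := by
    rw [uIcc_of_le zero_le_one]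
    exact ContinuousOn.inv₀ (by fun_prop) fun s hs => (hpos s hs).ne'
  rw [← intervalIntegral.integral_const_mul,
    intervalIntegral.integral_eq_sub_of_hasDerivAt (f := fun s => Real.log (1 + s * w))]
  · simp
  · intro s hs
    rw [uIcc_of_le zero_le_one] at hs
    have h := (((hasDerivAt_id s).mul_const w).const_add 1).log (hpos s hs).ne'
    simpa [div_eq_mul_inv] using h
  · exact (hcont.const_mul w).intervalIntegrable

/-- The function `w ↦ log (1 + w) / w` is convex on `(-1, ∞)`, being the average over `s ∈ [0, 1]` of
`w ↦ 1 / (1 + s w)`. So it lies above its tangent line at `v`, whose slope is `-κ`; the inequality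
is stated after multiplication by `w`. -/
lemma exists_log_one_add_tangent {v : ℝ} (hv : -1 < v) (hv0 : v ≠ 0) :
    ∃ κ : ℝ, ∀ w : ℝ, -1 < w →
      (0 ≤ w → w * (Real.log (1 + v) / v - κ * (w - v)) ≤ Real.log (1 + w)) ∧
      (w ≤ 0 → Real.log (1 + w) ≤ w * (Real.log (1 + v) / v - κ * (w - v))) := by
  have hpos : ∀ w : ℝ, -1 < w → ∀ s ∈ Icc (0 : ℝ) 1, 0 < 1 + s * w := by
    intro w hw s hs
    rcases le_total 0 w with h | h <;> nlinarith [hs.1, hs.2]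
  have hint : ∀ w : ℝ, -1 < w →
      IntervalIntegrable (fun s : ℝ => (1 + s * w)⁻¹) volume 0 1 := by
    intro w hw
    refine ContinuousOn.intervalIntegrable ?_
    rw [uIcc_of_le zero_le_one]
    exact ContinuousOn.inv₀ (by fun_prop) fun s hs => (hpos w hw s hs).ne'
  have hint2 : IntervalIntegrable (fun s : ℝ => s * ((1 + s * v) ^ 2)⁻¹) volume 0 1 := by
    refine ContinuousOn.intervalIntegrable ?_
    rw [uIcc_of_le zero_le_one]
    exact ContinuousOn.mul (by fun_prop)
      (ContinuousOn.inv₀ (by fun_prop) fun s hs => (pow_pos (hpos v hv s hs) 2).ne')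
  refine ⟨∫ s in (0 : ℝ)..1, s * ((1 + s * v) ^ 2)⁻¹, fun w hw => ?_⟩
  have hL : Real.log (1 + v) / v = ∫ s in (0 : ℝ)..1, (1 + s * v)⁻¹ := by
    rw [← mul_integral_inv_one_add_mul hv]
    field_simp
  have key : (∫ s in (0 : ℝ)..1, (1 + s * v)⁻¹) -
      (∫ s in (0 : ℝ)..1, s * ((1 + s * v) ^ 2)⁻¹) * (w - v) ≤
      ∫ s in (0 : ℝ)..1, (1 + s * w)⁻¹ := by
    rw [← intervalIntegral.integral_mul_const,
      ← intervalIntegral.integral_sub (hint v hv) (hint2.mul_const _)]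
    refine intervalIntegral.integral_mono_on zero_le_one ((hint v hv).sub (hint2.mul_const _))
      (hint w hw) fun s hs => ?_
    have hA := hpos w hw s hs
    have hB := hpos v hv s hs
    have : (1 + s * w)⁻¹ - ((1 + s * v)⁻¹ - s * ((1 + s * v) ^ 2)⁻¹ * (w - v)) =
        (s * (w - v)) ^ 2 / ((1 + s * w) * (1 + s * v) ^ 2) := by
      field_simp
      ring
    have h2 : 0 ≤ (s * (w - v)) ^ 2 / ((1 + s * w) * (1 + s * v) ^ 2) := by positivity
    linarith
  rw [hL, ← mul_integral_inv_one_add_mul hw]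
  exact ⟨fun h => mul_le_mul_of_nonneg_left key h, fun h => mul_le_mul_of_nonpos_left key h⟩

/-- The Taylor remainder of second order of `(1 + u) ^ s` is monotone for `0 < s ≤ 1`: its derivative
is nonnegative by Bernoulli's inequality with exponent `s - 1`. -/
lemma monotoneOn_rpow_one_add_sub_taylor {s : ℝ} (hs0 : 0 < s) (hs1 : s ≤ 1) :
    MonotoneOn (fun u : ℝ => (1 + u) ^ s - (1 + s * u + s * (s - 1) / 2 * u ^ 2)) (Ici (-1)) := by
  have hd : ∀ u : ℝ, -1 < u →
      HasDerivAt (fun u : ℝ => (1 + u) ^ s - (1 + s * u + s * (s - 1) / 2 * u ^ 2))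
        (s * (1 + u) ^ (s - 1) - (s + s * (s - 1) * u)) u := by
    intro u hu
    have h1 : HasDerivAt (fun u : ℝ => (1 + u) ^ s) (s * (1 + u) ^ (s - 1)) u := by
      have := ((hasDerivAt_id u).const_add 1).rpow_const (p := s)
        (Or.inl (by simp only [id]; linarith))
      simpa using this
    have h2 : HasDerivAt (fun u : ℝ => 1 + s * u + s * (s - 1) / 2 * u ^ 2)
        (s + s * (s - 1) * u) u := by
      have h := (((hasDerivAt_id u).const_mul s).const_add 1).add
        ((hasDerivAt_pow 2 u).const_mul (s * (s - 1) / 2))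
      exact h.congr_deriv (by norm_num; ring)
    exact h1.sub h2
  refine monotoneOn_of_deriv_nonneg (convex_Ici _) ?_ ?_ ?_
  · refine ContinuousOn.sub ?_ (by fun_prop)
    exact ContinuousOn.rpow_const (by fun_prop) fun u _ => Or.inr hs0.le
  · intro u hu
    rw [interior_Ici] at hu
    exact (hd u hu).differentiableAt.differentiableWithinAt
  · intro u hu
    rw [interior_Ici] at hu
    rw [(hd u hu).deriv]
    have hu' : 0 < 1 + u := by linarith [mem_Ioi.1 hu]
    -- Bernoulli for the exponent `s - 1 ∈ [-1, 0]`, from the one for `1 - s ∈ [0, 1]`.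
    have hB := rpow_one_add_le_one_add_mul_self (s := u) (p := 1 - s) (mem_Ioi.1 hu).le
      (by linarith) (by linarith)
    have hpos : 0 < (1 + u) ^ (1 - s) := Real.rpow_pos_of_pos hu' _
    have hinv : (1 + u) ^ (s - 1) * (1 + u) ^ (1 - s) = 1 := by
      rw [← Real.rpow_add hu']
      simp
    have hpos' : 0 < (1 + u) ^ (s - 1) := Real.rpow_pos_of_pos hu' _
    have : 1 + (s - 1) * u ≤ (1 + u) ^ (s - 1) := by
      nlinarith [sq_nonneg ((1 + u) ^ (s - 1) - 1)]
    nlinarith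

/-- `1 + 2pu + pu² - (1 + u)^(2p)` is `E X - exp E ln X` when `√X` is `1 + u` with probability `p`
and `1` otherwise. -/
lemma twoPoint_gap_le {p u : ℝ} (hp0 : 0 < p) (hu : 0 ≤ u) :
    1 + 2 * p * u + p * u ^ 2 - (1 + u) ^ (2 * p) ≤ p * u ^ 2 * max (2 * (1 - p)) 1 := by
  have hsq : 0 ≤ p * u ^ 2 := by positivity
  rcases le_total (2 * p) 1 with h | h
  · have hm := monotoneOn_rpow_one_add_sub_taylor (s := 2 * p) (by linarith) h
      (mem_Ici.2 (by norm_num : (-1 : ℝ) ≤ 0)) (mem_Ici.2 (by linarith : -1 ≤ u)) hu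
    norm_num at hm
    have := mul_le_mul_of_nonneg_left (le_max_left (2 * (1 - p)) 1) hsq
    nlinarith
  · have hm := one_add_mul_self_le_rpow_one_add (s := u) (by linarith) h
    have := mul_le_mul_of_nonneg_left (le_max_right (2 * (1 - p)) 1) hsq
    nlinarith

/-- Here `X` has its larger atom at `1`, with probability `1 - p`. -/
lemma le_twoPoint_gap {p u : ℝ} (hp0 : 0 < p) (hp1 : p ≤ 1) (hu : -1 ≤ u) (hu0 : u ≤ 0) :
    u ^ 2 * min (2 * p * (1 - p)) (1 - p) ≤
      1 + 2 * p * u + p * u ^ 2 - (1 + u) ^ (2 * p) := by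
  have hsq : 0 ≤ u ^ 2 := by positivity
  rcases le_total (2 * p) 1 with h | h
  · have hm := monotoneOn_rpow_one_add_sub_taylor (s := 2 * p) (by linarith) h
      (mem_Ici.2 hu) (mem_Ici.2 (by norm_num : (-1 : ℝ) ≤ 0)) hu0
    norm_num at hm
    have := mul_le_mul_of_nonneg_left (min_le_left (2 * p * (1 - p)) (1 - p)) hsq
    nlinarith
  · have hm := rpow_one_add_le_one_add_mul_self (s := u) (p := 2 * p - 1) hu (by linarith)
      (by linarith)
    have he : (1 + u) ^ (2 * p) = (1 + u) ^ (2 * p - 1) * (1 + u) := by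
      rw [← Real.rpow_add_one' (by linarith) (by linarith)]
      congr 1
      ring
    have := mul_le_mul_of_nonneg_left (min_le_right (2 * p * (1 - p)) (1 - p)) hsq
    have := mul_le_mul_of_nonneg_right hm (by linarith : 0 ≤ 1 + u)
    nlinarith

open Filter Topology in
lemma tendsto_twoPoint_gap_div_sq (p : ℝ) :
    Tendsto (fun u : ℝ => (1 + 2 * p * u + p * u ^ 2 - (1 + u) ^ (2 * p)) / u ^ 2) (𝓝[≠] 0)
      (𝓝 (2 * p * (1 - p))) := by
  have hpow : ∀ r u : ℝ, -1 < u → HasDerivAt (fun u : ℝ => (1 + u) ^ r) (r * (1 + u) ^ (r - 1)) u := by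
    intro r u hu
    have := ((hasDerivAt_id u).const_add 1).rpow_const (p := r)
      (Or.inl (by simp only [id]; linarith))
    simpa using this
  have hlt : ∀ᶠ u : ℝ in 𝓝[≠] 0, -1 < u :=
    eventually_nhdsWithin_of_eventually_nhds (lt_mem_nhds (by norm_num))
  have hd : ∀ u : ℝ, -1 < u →
      HasDerivAt (fun u : ℝ => 1 + 2 * p * u + p * u ^ 2 - (1 + u) ^ (2 * p))
        (2 * p + 2 * p * u - 2 * p * (1 + u) ^ (2 * p - 1)) u := by
    intro u hu
    have h := ((((hasDerivAt_id u).const_mul (2 * p)).const_add 1).add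
        ((hasDerivAt_pow 2 u).const_mul p)).sub (hpow (2 * p) u hu)
    exact h.congr_deriv (by norm_num; ring)
  have h0 := (hd 0 (by norm_num)).continuousAt.tendsto
  refine HasDerivAt.lhopital_zero_nhdsNE (f' := fun u => 2 * p + 2 * p * u - 2 * p * (1 + u) ^ (2 * p - 1))
    (g' := fun u => 2 * u) (hlt.mono hd) (.of_forall fun u => by simpa using hasDerivAt_pow 2 u) ?_ ?_ ?_ ?_
  · filter_upwards [self_mem_nhdsWithin] with u hu
    simpa using hu
  · refine tendsto_nhdsWithin_of_tendsto_nhds ?_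
    simpa using h0
  · refine tendsto_nhdsWithin_of_tendsto_nhds ?_
    have : ContinuousAt (fun u : ℝ => u ^ 2) 0 := by fun_prop
    simpa [ContinuousAt] using this
  · have hs := (hasDerivAt_iff_tendsto_slope.1 (hpow (2 * p - 1) 0 (by norm_num)))
    have h2 := (hs.const_mul (-p)).const_add p
    have hval : p + -p * ((2 * p - 1) * (1 + 0) ^ (2 * p - 1 - 1)) = 2 * p * (1 - p) := by
      norm_num
      ring
    rw [hval] at h2
    refine h2.congr' ?_
    · filter_upwards [self_mem_nhdsWithin] with u hu
      have : u ≠ 0 := hu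
      simp [slope_def_field]
      field_simp
      ring

/-! ### Extended-real expectations and the geometric mean -/

lemma eexpect_mono {Ω : Type u} [MeasurableSpace Ω] {P : Measure Ω} {f g : Ω → EReal}
    (h : f ≤ᵐ[P] g) : eexpect P f ≤ eexpect P g := by
  refine EReal.sub_le_sub ?_ ?_
  · exact EReal.coe_ennreal_le_coe_ennreal_iff.2
      (lintegral_mono_ae (h.mono fun ω hω => EReal.toENNReal_le_toENNReal hω))
  · exact EReal.coe_ennreal_le_coe_ennreal_iff.2
      (lintegral_mono_ae (h.mono fun ω hω =>
        EReal.toENNReal_le_toENNReal (EReal.neg_le_neg_iff.2 hω)))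

lemma eexpect_coe {Ω : Type u} [MeasurableSpace Ω] {P : Measure Ω} {f : Ω → ℝ}
    (hf : Integrable f P) : eexpect P (fun ω => (f ω : EReal)) = ((∫ ω, f ω ∂P : ℝ) : EReal) := by
  rw [integral_eq_lintegral_pos_part_sub_lintegral_neg_part hf, EReal.coe_sub, eexpect]
  have h1 : ∫⁻ ω, ENNReal.ofReal (f ω) ∂P ≠ ∞ := hf.lintegral_lt_top.ne
  have h2 : ∫⁻ ω, ENNReal.ofReal (-f ω) ∂P ≠ ∞ := hf.neg.lintegral_lt_top.ne
  congr 1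
  · exact (EReal.coe_ennreal_toReal h1).symm
  · exact (EReal.coe_ennreal_toReal h2).symm

namespace NonnegRV

variable (R : NonnegRV.{u})

/-- The geometric mean `exp E ln X`, as a real number; it is finite since `ln X ≤ X`. -/
noncomputable def geo : ℝ := (EReal.exp R.expectLog).toReal

lemma D_eq : R.D = (∫ ω, R.X ω ∂(R.P)) - R.geo := rfl

lemma geo_nonneg : 0 ≤ R.geo := ENNReal.toReal_nonneg

variable {R}

lemma geo_le_exp_integral {l : R.Ω → ℝ} (hl : Integrable l R.P)
    (h : ∀ᵐ ω ∂(R.P), 0 < R.X ω → Real.log (R.X ω) ≤ l ω) :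
    R.geo ≤ Real.exp (∫ ω, l ω ∂(R.P)) := by
  have h1 : R.expectLog ≤ ((∫ ω, l ω ∂(R.P) : ℝ) : EReal) := by
    rw [← eexpect_coe hl]
    refine eexpect_mono (h.mono fun ω hω => ?_)
    dsimp only
    rw [ENNReal.log_ofReal]
    split_ifs with h0
    · exact bot_le
    · exact EReal.coe_le_coe_iff.2 (hω (not_le.1 h0))
  refine ENNReal.toReal_le_of_le_ofReal (Real.exp_pos _).le ?_
  simpa using EReal.exp_monotone h1

lemma exp_integral_le_geo {l : R.Ω → ℝ} (hl : Integrable l R.P)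
    (h : ∀ᵐ ω ∂(R.P), 0 < R.X ω ∧ l ω ≤ Real.log (R.X ω)) :
    Real.exp (∫ ω, l ω ∂(R.P)) ≤ R.geo := by
  have h1 : ((∫ ω, l ω ∂(R.P) : ℝ) : EReal) ≤ R.expectLog := by
    rw [← eexpect_coe hl]
    refine eexpect_mono (h.mono fun ω hω => ?_)
    dsimp only
    rw [ENNReal.log_ofReal_of_pos hω.1]
    exact EReal.coe_le_coe_iff.2 hω.2
  have h2 : R.expectLog ≤ ((∫ ω, R.X ω ∂(R.P) : ℝ) : EReal) := by
    rw [← eexpect_coe R.integrable_X]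
    refine eexpect_mono (.of_forall fun ω => ?_)
    dsimp only
    rw [ENNReal.log_ofReal]
    split_ifs with h0
    · exact bot_le
    · exact EReal.coe_le_coe_iff.2 (Real.log_le_self (R.nonneg_X ω))
  have h3 : EReal.exp R.expectLog ≠ ∞ :=
    ne_top_of_le_ne_top (by simp) (EReal.exp_monotone h2)
  rw [geo, ← ENNReal.ofReal_le_iff_le_toReal h3]
  simpa using EReal.exp_monotone h1

lemma geo_eq_zero (h : R.P {ω | R.X ω = 0} ≠ 0) : R.geo = 0 := by
  have hneg : ∫⁻ ω, (-ENNReal.log (ENNReal.ofReal (R.X ω))).toENNReal ∂(R.P) = ∞ := by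
    refine lintegral_eq_top_of_measure_eq_top_ne_zero ?_ ?_
    · refine Measurable.aemeasurable ?_
      have := R.measurable_X
      fun_prop
    · convert h using 3
      ext ω
      simp only [EReal.toENNReal_eq_top_iff, EReal.neg_eq_top_iff,
        ENNReal.log_eq_bot_iff, ENNReal.ofReal_eq_zero]
      exact ⟨fun h => le_antisymm h (R.nonneg_X ω), fun h => h.le⟩
  have : R.expectLog = ⊥ := by
    rw [expectLog, eexpect, hneg]
    simp [sub_eq_add_neg]
  simp [geo, this]

variable (R)

/-! ### Moments of the square root -/

lemma measurable_sqrt : Measurable fun ω => √(R.X ω) := R.measurable_X.sqrt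

lemma memLp_sqrt : MemLp (fun ω => √(R.X ω)) 2 R.P := by
  rw [memLp_two_iff_integrable_sq R.measurable_sqrt.aestronglyMeasurable]
  simpa only [Real.sq_sqrt (R.nonneg_X _)] using R.integrable_X

lemma integrable_sqrt : Integrable (fun ω => √(R.X ω)) R.P :=
  R.memLp_sqrt.integrable (by norm_num)

lemma integrable_sqrt_sub (a : ℝ) : Integrable (fun ω => √(R.X ω) - a) R.P :=
  R.integrable_sqrt.sub (integrable_const a)

lemma integrable_sqrt_sub_sq (a : ℝ) : Integrable (fun ω => (√(R.X ω) - a) ^ 2) R.P :=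
  (R.memLp_sqrt.sub (memLp_const a)).integrable_sq

lemma integral_sqrt_sub (a : ℝ) : ∫ ω, (√(R.X ω) - a) ∂(R.P) = (∫ ω, √(R.X ω) ∂(R.P)) - a := by
  rw [integral_sub R.integrable_sqrt (integrable_const a)]
  simp

lemma integral_eq_V_add_sq : ∫ ω, R.X ω ∂(R.P) = R.V + (∫ ω, √(R.X ω) ∂(R.P)) ^ 2 := by
  have h := variance_eq_sub R.memLp_sqrt
  have h2 : R.P[(fun ω => √(R.X ω)) ^ 2] = ∫ ω, R.X ω ∂(R.P) :=
    integral_congr_ae (.of_forall fun ω => Real.sq_sqrt (R.nonneg_X ω))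
  rw [h2] at h
  rw [V, h]
  ring

lemma integral_eq_of_shift (a : ℝ) : ∫ ω, R.X ω ∂(R.P) =
    (∫ ω, (√(R.X ω) - a) ^ 2 ∂(R.P)) + 2 * a * (∫ ω, (√(R.X ω) - a) ∂(R.P)) + a ^ 2 := by
  have h : ∀ ω, R.X ω = (√(R.X ω) - a) ^ 2 + 2 * a * (√(R.X ω) - a) + a ^ 2 := by
    intro ω
    have := Real.sq_sqrt (R.nonneg_X ω)
    linear_combination -this
  calc ∫ ω, R.X ω ∂(R.P)
      = ∫ ω, ((√(R.X ω) - a) ^ 2 + 2 * a * (√(R.X ω) - a) + a ^ 2) ∂(R.P) :=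
        integral_congr_ae (.of_forall h)
    _ = _ := by
        rw [integral_add _ (integrable_const _), integral_add (R.integrable_sqrt_sub_sq a)
          ((R.integrable_sqrt_sub a).const_mul _), integral_const_mul]
        · simp
        · exact (R.integrable_sqrt_sub_sq a).add ((R.integrable_sqrt_sub a).const_mul _)

lemma integral_sqrt_sub_sq (a : ℝ) : ∫ ω, (√(R.X ω) - a) ^ 2 ∂(R.P) =
    R.V + (∫ ω, (√(R.X ω) - a) ∂(R.P)) ^ 2 := by
  have h1 := R.integral_eq_of_shift a
  rw [R.integral_eq_V_add_sq, R.integral_sqrt_sub a] at h1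
  rw [R.integral_sqrt_sub a]
  linear_combination -h1

lemma V_nonneg : 0 ≤ R.V := variance_nonneg _ _

/-! ### The ends of the support -/

lemma ae_mem_supp : ∀ᵐ ω ∂(R.P), R.X ω ∈ R.supp :=
  ae_of_ae_map R.measurable_X.aemeasurable Measure.support_mem_ae

lemma supp_subset {t : Set ℝ} (ht : IsClosed t) (h : ∀ᵐ ω ∂(R.P), R.X ω ∈ t) : R.supp ⊆ t :=
  Measure.support_subset_of_isClosed ht
    ((ae_map_iff R.measurable_X.aemeasurable ht.measurableSet).2 h)

lemma supp_subset_Ici : R.supp ⊆ Ici 0 :=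
  R.supp_subset isClosed_Ici (.of_forall R.nonneg_X)

lemma supp_nonempty : R.supp.Nonempty := by
  obtain ⟨ω, hω⟩ := R.ae_mem_supp.exists
  exact ⟨_, hω⟩

variable {R} in
lemma mem_supp_of_atom {x : ℝ} (h : R.P {ω | R.X ω = x} ≠ 0) : x ∈ R.supp := by
  refine (Measure.mem_support_iff_forall x).2 fun U hU => ?_
  refine lt_of_lt_of_le (pos_iff_ne_zero.2 h) ((measure_mono ?_).trans
    (Measure.le_map_apply R.measurable_X.aemeasurable U))
  rintro ω rfl
  exact mem_preimage.2 (mem_of_mem_nhds (x := R.X ω) hU)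

lemma m_nonneg : 0 ≤ R.m := Real.sInf_nonneg fun _ hx => R.supp_subset_Ici hx

lemma ae_m_le : ∀ᵐ ω ∂(R.P), R.m ≤ R.X ω :=
  R.ae_mem_supp.mono fun _ hω => csInf_le ⟨0, fun _ hx => R.supp_subset_Ici hx⟩ hω

lemma le_M {x : ℝ} (hx : x ∈ R.supp) : (x : EReal) ≤ R.M :=
  le_iSup₂ (f := fun (x : ℝ) (_ : x ∈ R.supp) => (x : EReal)) x hx

lemma M_nonneg : 0 ≤ R.M := by
  obtain ⟨x, hx⟩ := R.supp_nonempty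
  exact le_trans (EReal.coe_nonneg.2 (R.supp_subset_Ici hx)) (R.le_M hx)

lemma coe_toReal_M (h : R.M ≠ ⊤) : (R.M.toReal : EReal) = R.M :=
  EReal.coe_toReal h (ne_bot_of_le_ne_bot (by simp) R.M_nonneg)

lemma ae_le_M (h : R.M ≠ ⊤) : ∀ᵐ ω ∂(R.P), R.X ω ≤ R.M.toReal := by
  filter_upwards [R.ae_mem_supp] with ω hω
  rw [← EReal.coe_le_coe_iff, R.coe_toReal_M h]
  exact R.le_M hω

variable {R}

lemma m_eq_of_atom {x : ℝ} (hx : R.P {ω | R.X ω = x} ≠ 0) (h : ∀ ω, x ≤ R.X ω) : R.m = x :=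
  IsLeast.csInf_eq ⟨mem_supp_of_atom hx, R.supp_subset isClosed_Ici (.of_forall h)⟩

lemma M_eq_of_atom {x : ℝ} (hx : R.P {ω | R.X ω = x} ≠ 0) (h : ∀ ω, R.X ω ≤ x) :
    R.M = (x : EReal) := by
  refine le_antisymm (iSup₂_le fun y hy => ?_) (R.le_M (mem_supp_of_atom hx))
  exact EReal.coe_le_coe_iff.2 (R.supp_subset isClosed_Iic (.of_forall h) hy)

lemma M_le_of_ae_le {b : ℝ} (h : ∀ᵐ ω ∂(R.P), R.X ω ≤ b) : R.M ≤ (b : EReal) :=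
  iSup₂_le fun _ hy => EReal.coe_le_coe_iff.2 (R.supp_subset isClosed_Iic h hy)

lemma ae_eq_const_of_V_eq_zero (h : R.V = 0) :
    ∀ᵐ ω ∂(R.P), √(R.X ω) = ∫ ω, √(R.X ω) ∂(R.P) := by
  have h1 := R.integral_sqrt_sub_sq (∫ ω, √(R.X ω) ∂(R.P))
  rw [R.integral_sqrt_sub, h, sub_self] at h1
  have h2 := (integral_eq_zero_iff_of_nonneg (fun ω => by positivity)
    (R.integrable_sqrt_sub_sq _)).1 (h1.trans (by norm_num))
  filter_upwards [h2] with ω hω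
  exact sub_eq_zero.1 (pow_eq_zero_iff two_ne_zero |>.1 hω)

end NonnegRV

/-! ### Bounds for the difference of the means -/

namespace NonnegRV

variable {R : NonnegRV.{u}}

/-- Jensen's inequality for the logarithm, applied to `√X`. -/
lemma geo_le_sq_integral_sqrt : R.geo ≤ (∫ ω, √(R.X ω) ∂(R.P)) ^ 2 := by
  set μ := ∫ ω, √(R.X ω) ∂(R.P) with hμ
  have hμ0 : 0 ≤ μ := integral_nonneg fun ω => Real.sqrt_nonneg _
  rcases hμ0.eq_or_lt with h | h
  · have h0 := (integral_eq_zero_iff_of_nonneg (fun ω => Real.sqrt_nonneg (R.X ω))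
      R.integrable_sqrt).1 h.symm
    have h1 : ∀ᵐ ω ∂(R.P), R.X ω = 0 := by
      filter_upwards [h0] with ω hω
      exact (Real.sqrt_eq_zero (R.nonneg_X ω)).1 hω
    rw [geo_eq_zero (by rw [show R.P {ω | R.X ω = 0} = 1 from (prob_compl_eq_zero_iff₀
      (R.measurable_X (measurableSet_singleton 0)).nullMeasurableSet).1 h1]; exact one_ne_zero)]
    positivity
  · have h1 : R.geo ≤
        Real.exp (∫ ω, (2 * Real.log μ + 2 / μ * (√(R.X ω) - μ)) ∂(R.P)) := by
      refine geo_le_exp_integral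
        ((integrable_const _).add ((R.integrable_sqrt_sub μ).const_mul _))
        (.of_forall fun ω hω => ?_)
      have hs : 0 < √(R.X ω) := Real.sqrt_pos.2 hω
      have h2 := Real.log_le_sub_one_of_pos (div_pos hs h)
      rw [Real.log_div hs.ne' h.ne', Real.log_sqrt hω.le] at h2
      have h3 : 2 / μ * (√(R.X ω) - μ) = 2 * (√(R.X ω) / μ - 1) := by field_simp
      rw [h3]
      linarith
    refine h1.trans (le_of_eq ?_)
    rw [integral_add (integrable_const _) ((R.integrable_sqrt_sub μ).const_mul _),
      integral_const_mul (2 / μ), R.integral_sqrt_sub, ← hμ]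
    simp only [integral_const, probReal_univ, sub_self, mul_zero, add_zero, smul_eq_mul, one_mul]
    rw [mul_comm, Real.exp_mul, Real.exp_log h]
    norm_num

lemma V_le_D : R.V ≤ R.D := by
  rw [D_eq, R.integral_eq_V_add_sq]
  linarith [geo_le_sq_integral_sqrt (R := R)]

lemma D_eq_zero_of_V_eq_zero (h : R.V = 0) : R.D = 0 := by
  refine le_antisymm ?_ (h ▸ V_le_D)
  rw [D_eq, R.integral_eq_V_add_sq, h]
  have h1 := ae_eq_const_of_V_eq_zero h
  set μ := ∫ ω, √(R.X ω) ∂(R.P)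
  have hμ0 : 0 ≤ μ := integral_nonneg fun ω => Real.sqrt_nonneg _
  rcases hμ0.eq_or_lt with h0 | h0
  · rw [← h0]
    linarith [R.geo_nonneg]
  · have h2 : Real.exp (∫ _, Real.log (μ ^ 2) ∂(R.P)) ≤ R.geo := by
      refine exp_integral_le_geo (integrable_const _) ?_
      filter_upwards [h1] with ω hω
      rw [← hω, Real.sq_sqrt (R.nonneg_X ω)]
      refine ⟨?_, le_rfl⟩
      rw [← hω] at h0
      exact Real.sqrt_pos.1 h0
    simp only [integral_const, probReal_univ, smul_eq_mul, one_mul,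
      Real.exp_log (pow_pos h0 2)] at h2
    linarith

lemma integrable_quadratic (a A B C : ℝ) :
    Integrable (fun ω => A + B * (√(R.X ω) - a) + C * (√(R.X ω) - a) ^ 2) R.P :=
  ((integrable_const A).add ((R.integrable_sqrt_sub a).const_mul B)).add
    ((R.integrable_sqrt_sub_sq a).const_mul C)

lemma integral_quadratic (a A B C : ℝ) :
    ∫ ω, (A + B * (√(R.X ω) - a) + C * (√(R.X ω) - a) ^ 2) ∂(R.P) =
      A + B * (∫ ω, (√(R.X ω) - a) ∂(R.P)) + C * ∫ ω, (√(R.X ω) - a) ^ 2 ∂(R.P) := by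
  have h1 : Integrable (fun ω => A + B * (√(R.X ω) - a)) R.P :=
    (integrable_const A).add ((R.integrable_sqrt_sub a).const_mul B)
  rw [integral_add h1 ((R.integrable_sqrt_sub_sq a).const_mul C),
    integral_add (integrable_const A) ((R.integrable_sqrt_sub a).const_mul B),
    integral_const_mul, integral_const_mul]
  simp

/-! ### Comparison of geometric means -/

lemma log_tangent_eq (a L κ u : ℝ) (ω : R.Ω) :
    2 * Real.log a + 2 * ((√(R.X ω) - a) / a * (L - κ * ((√(R.X ω) - a) / a - u))) =
      2 * Real.log a + 2 * (L + κ * u) / a * (√(R.X ω) - a) +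
        -(2 * κ / a ^ 2) * (√(R.X ω) - a) ^ 2 := by
  field_simp
  ring

lemma integrable_log_tangent (a L κ u : ℝ) : Integrable (fun ω => 2 * Real.log a +
    2 * ((√(R.X ω) - a) / a * (L - κ * ((√(R.X ω) - a) / a - u)))) R.P := by
  simp_rw [log_tangent_eq]
  exact integrable_quadratic _ _ _ _

/-- With `Z = √X - a` and `u = e / (a z) = E Z² / (a E Z)`, the quadratic `Z (Z - a u)` has mean
zero, so that the slope `κ` of the tangent line disappears after integration. -/
lemma integral_log_tangent {a z e : ℝ} (ha : 0 < a) (hz : z ≠ 0)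
    (hzZ : ∫ ω, (√(R.X ω) - a) ∂(R.P) = z) (heZ : ∫ ω, (√(R.X ω) - a) ^ 2 ∂(R.P) = e)
    (L κ : ℝ) :
    ∫ ω, (2 * Real.log a + 2 * ((√(R.X ω) - a) / a *
      (L - κ * ((√(R.X ω) - a) / a - e / (a * z))))) ∂(R.P) = 2 * Real.log a + 2 * z / a * L := by
  simp_rw [log_tangent_eq]
  rw [integral_quadratic, hzZ, heZ]
  field_simp
  ring

lemma exp_log_tangent {a z e : ℝ} (ha : 0 < a) (hz : z ≠ 0) (he : e ≠ 0)
    (hu : -1 < e / (a * z)) :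
    Real.exp (2 * Real.log a + 2 * z / a *
      (Real.log (1 + e / (a * z)) / (e / (a * z)))) =
      a ^ 2 * (1 + e / (a * z)) ^ (2 * (z ^ 2 / e)) := by
  have h1 : 2 * z / a * (Real.log (1 + e / (a * z)) / (e / (a * z))) =
      Real.log (1 + e / (a * z)) * (2 * (z ^ 2 / e)) := by
    field_simp
  rw [h1, Real.exp_add, mul_comm 2 (Real.log a), Real.exp_mul, Real.exp_log ha,
    Real.rpow_def_of_pos (by linarith : 0 < 1 + e / (a * z))]
  norm_num

/-- Among the `X` with `√X ≥ a` and prescribed first two moments of `√X`, the geometric mean is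
smallest for the two-point distribution with one atom at `√X = a`. -/
lemma twoPoint_le_geo {a z e : ℝ} (ha : 0 < a) (hz : 0 < z) (he : 0 < e)
    (hzZ : ∫ ω, (√(R.X ω) - a) ∂(R.P) = z) (heZ : ∫ ω, (√(R.X ω) - a) ^ 2 ∂(R.P) = e)
    (hle : ∀ᵐ ω ∂(R.P), a ≤ √(R.X ω)) :
    a ^ 2 * (1 + e / (a * z)) ^ (2 * (z ^ 2 / e)) ≤ R.geo := by
  have hu : 0 < e / (a * z) := by positivity
  obtain ⟨κ, hκ⟩ := exists_log_one_add_tangent (v := e / (a * z)) (by linarith) hu.ne'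
  rw [← exp_log_tangent ha hz.ne' he.ne' (by linarith),
    ← integral_log_tangent ha hz.ne' hzZ heZ _ κ]
  refine exp_integral_le_geo (integrable_log_tangent _ _ _ _) ?_
  filter_upwards [hle] with ω hω
  have hs : 0 < √(R.X ω) := ha.trans_le hω
  have hX : 0 < R.X ω := Real.sqrt_pos.1 hs
  refine ⟨hX, ?_⟩
  have hw : 0 ≤ (√(R.X ω) - a) / a := div_nonneg (by linarith) ha.le
  have h1 := (hκ ((√(R.X ω) - a) / a) (by linarith)).1 hw
  have h2 : 1 + (√(R.X ω) - a) / a = √(R.X ω) / a := by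
    field_simp
    ring
  rw [h2, Real.log_div hs.ne' ha.ne', Real.log_sqrt hX.le] at h1
  linarith

/-- Among the `X` with `√X ≤ a` and prescribed first two moments of `√X`, the geometric mean is
largest for the two-point distribution with one atom at `√X = a`. -/
lemma geo_le_twoPoint {a z e : ℝ} (ha : 0 < a) (hz : z < 0) (he : 0 < e)
    (hzZ : ∫ ω, (√(R.X ω) - a) ∂(R.P) = z) (heZ : ∫ ω, (√(R.X ω) - a) ^ 2 ∂(R.P) = e)
    (hle : ∀ᵐ ω ∂(R.P), √(R.X ω) ≤ a) :
    -1 ≤ e / (a * z) ∧ R.geo ≤ a ^ 2 * (1 + e / (a * z)) ^ (2 * (z ^ 2 / e)) := by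
  have haz : a * z < 0 := mul_neg_of_pos_of_neg ha hz
  have hsplit : ∀ ω, (a - √(R.X ω)) * √(R.X ω) =
      -((√(R.X ω) - a) ^ 2 + a * (√(R.X ω) - a)) := fun ω => by ring
  have hI : Integrable (fun ω => (a - √(R.X ω)) * √(R.X ω)) R.P := by
    simp_rw [hsplit]
    exact ((R.integrable_sqrt_sub_sq a).add ((R.integrable_sqrt_sub a).const_mul a)).neg
  have hval : ∫ ω, (a - √(R.X ω)) * √(R.X ω) ∂(R.P) = -(e + a * z) := by
    simp_rw [hsplit]
    rw [integral_neg, integral_add (R.integrable_sqrt_sub_sq a)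
      ((R.integrable_sqrt_sub a).const_mul a), integral_const_mul, hzZ, heZ]
  have hnn : 0 ≤ᵐ[R.P] fun ω => (a - √(R.X ω)) * √(R.X ω) := by
    filter_upwards [hle] with ω hω
    exact mul_nonneg (sub_nonneg.2 hω) (Real.sqrt_nonneg _)
  have hu : -1 ≤ e / (a * z) := by
    rw [le_div_iff_of_neg haz]
    linarith [hval ▸ integral_nonneg_of_ae hnn]
  refine ⟨hu, ?_⟩
  have hu0 : e / (a * z) < 0 := div_neg_of_pos_of_neg he haz
  rcases hu.eq_or_lt with h | h
  · -- Here `√X` takes only the values `0` and `a` almost surely, so that `X` has an atom at `0`.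
    rw [geo_eq_zero ?_]
    · rw [← h]
      exact mul_nonneg (by positivity) (Real.rpow_nonneg (by norm_num) _)
    · intro hP
      have hpos : ∀ᵐ ω ∂(R.P), R.X ω ≠ 0 := measure_eq_zero_iff_ae_notMem.1 hP
      have hez : e + a * z = 0 := by
        have := (div_eq_iff haz.ne).1 h.symm
        linarith
      rw [hez, neg_zero] at hval
      have h0 := (integral_eq_zero_iff_of_nonneg_ae hnn hI).1 hval
      have hZ : ∀ᵐ ω ∂(R.P), √(R.X ω) - a = 0 := by
        filter_upwards [h0, hpos] with ω h1 h2
        rcases mul_eq_zero.1 (show (a - √(R.X ω)) * √(R.X ω) = 0 from h1) with h3 | h3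
        · linarith
        · exact absurd ((Real.sqrt_eq_zero (R.nonneg_X ω)).1 h3) h2
      rw [integral_congr_ae hZ] at hzZ
      simp only [integral_zero] at hzZ
      exact hz.ne hzZ.symm
  · obtain ⟨κ, hκ⟩ := exists_log_one_add_tangent h hu0.ne
    rw [← exp_log_tangent ha hz.ne he.ne' h, ← integral_log_tangent ha hz.ne hzZ heZ _ κ]
    refine geo_le_exp_integral (integrable_log_tangent _ _ _ _) ?_
    filter_upwards [hle] with ω hω hX
    have hs : 0 < √(R.X ω) := Real.sqrt_pos.2 hX
    have h2 : 1 + (√(R.X ω) - a) / a = √(R.X ω) / a := by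
      field_simp
      ring
    have hw : (√(R.X ω) - a) / a ≤ 0 := div_nonpos_of_nonpos_of_nonneg (by linarith) ha.le
    have h1 := (hκ ((√(R.X ω) - a) / a) (by linarith [div_pos hs ha])).2 hw
    rw [h2, Real.log_div hs.ne' ha.ne', Real.log_sqrt hX.le] at h1
    linarith

variable (R)

lemma E_eq : R.E = R.V + (∫ ω, (√(R.X ω) - √R.m) ∂(R.P)) ^ 2 := R.integral_sqrt_sub_sq _

lemma V_le_E : R.V ≤ R.E := by
  rw [R.E_eq]
  nlinarith [sq_nonneg (∫ ω, (√(R.X ω) - √R.m) ∂(R.P))]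

lemma ae_sqrt_m_le : ∀ᵐ ω ∂(R.P), √R.m ≤ √(R.X ω) :=
  R.ae_m_le.mono fun _ h => Real.sqrt_le_sqrt h

lemma integral_sqrt_sub_m_pos (hV : 0 < R.V) : 0 < ∫ ω, (√(R.X ω) - √R.m) ∂(R.P) := by
  have hnn : 0 ≤ᵐ[R.P] fun ω => √(R.X ω) - √R.m :=
    R.ae_sqrt_m_le.mono fun ω h => sub_nonneg.2 h
  refine (integral_nonneg_of_ae hnn).lt_of_ne' fun h => ?_
  have h0 := (integral_eq_zero_iff_of_nonneg_ae hnn (R.integrable_sqrt_sub _)).1 h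
  have h1 := R.E_eq
  rw [h, E, integral_congr_ae (g := fun _ => 0) (h0.mono fun ω hω => by
    simp only [Pi.zero_apply] at hω
    simp [hω])] at h1
  simp at h1
  linarith

theorem D_le : R.D ≤ max (2 * R.V) R.E := by
  rcases R.V_nonneg.eq_or_lt with hV | hV
  · rw [D_eq_zero_of_V_eq_zero hV.symm, ← hV]
    simp
  rcases R.m_nonneg.eq_or_lt with hm | hm
  · refine le_max_of_le_right ?_
    have : R.E = ∫ ω, R.X ω ∂(R.P) := by
      simp only [E, ← hm, Real.sqrt_zero, sub_zero, Real.sq_sqrt (R.nonneg_X _)]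
    rw [D_eq, this]
    linarith [R.geo_nonneg]
  · have hz := R.integral_sqrt_sub_m_pos hV
    have hEz := R.E_eq
    have hX := R.integral_eq_of_shift (√R.m)
    change _ = R.E + _ + _ at hX
    have hE : 0 < R.E := hV.trans_le R.V_le_E
    have ha : 0 < √R.m := Real.sqrt_pos.2 hm
    have hgeo := twoPoint_le_geo ha hz hE rfl rfl R.ae_sqrt_m_le
    set z := ∫ ω, (√(R.X ω) - √R.m) ∂(R.P)
    set a := √R.m
    have hgap := twoPoint_gap_le (p := z ^ 2 / R.E) (u := R.E / (a * z)) (by positivity)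
      (by positivity)
    have h1 := mul_le_mul_of_nonneg_left hgap (sq_nonneg a)
    have e1 : a ^ 2 * (z ^ 2 / R.E * (R.E / (a * z)) ^ 2 * max (2 * (1 - z ^ 2 / R.E)) 1) =
        max (2 * R.V) R.E := by
      have : a ^ 2 * (z ^ 2 / R.E * (R.E / (a * z)) ^ 2) = R.E := by field_simp
      rw [← mul_assoc, this, mul_max_of_nonneg _ _ hE.le, mul_one]
      congr 1
      field_simp
      linarith
    have e2 : a ^ 2 * (1 + 2 * (z ^ 2 / R.E) * (R.E / (a * z)) +
        z ^ 2 / R.E * (R.E / (a * z)) ^ 2) = ∫ ω, R.X ω ∂(R.P) := by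
      rw [hX]
      field_simp
      ring
    rw [D_eq]
    rw [e1, mul_sub, e2] at h1
    linarith

lemma F_eq (h : R.M ≠ ⊤) : R.F = ((∫ ω, (√(R.X ω) - √R.M.toReal) ^ 2 ∂(R.P) : ℝ) : EReal) := by
  rw [F, if_neg h]
  congr 2
  ext ω
  ring

lemma F_eq_top_iff : R.F = ⊤ ↔ R.M = ⊤ := by
  by_cases h : R.M = ⊤
  · simp [F, h]
  · simp [R.F_eq h, h]

lemma ae_sqrt_le_M (h : R.M ≠ ⊤) : ∀ᵐ ω ∂(R.P), √(R.X ω) ≤ √R.M.toReal :=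
  (R.ae_le_M h).mono fun _ h => Real.sqrt_le_sqrt h

lemma integral_sqrt_sub_M_neg (h : R.M ≠ ⊤) (hV : 0 < R.V) :
    ∫ ω, (√(R.X ω) - √R.M.toReal) ∂(R.P) < 0 := by
  have hnn : (fun ω => √(R.X ω) - √R.M.toReal) ≤ᵐ[R.P] 0 :=
    (R.ae_sqrt_le_M h).mono fun ω h => sub_nonpos.2 h
  refine (integral_nonpos_of_ae hnn).lt_of_ne fun h => ?_
  have h0 : (fun ω => √(R.X ω) - √R.M.toReal) =ᵐ[R.P] 0 := by
    have := (integral_eq_zero_iff_of_nonneg_ae (hnn.mono fun ω hω => neg_nonneg.2 hω)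
      (R.integrable_sqrt_sub _).neg).1 (by rw [integral_neg, h, neg_zero])
    exact this.mono fun ω hω => neg_eq_zero.1 hω
  have h1 := R.integral_sqrt_sub_sq √R.M.toReal
  rw [h, integral_congr_ae (g := fun _ => 0) (h0.mono fun ω hω => by
    simp only [Pi.zero_apply] at hω
    simp [hω])] at h1
  simp at h1
  linarith

theorem le_D : min (2 * R.V) (ratioFV R.V R.F) ≤ R.D := by
  rcases R.V_nonneg.eq_or_lt with hV | hV
  · refine (min_le_left _ _).trans ?_
    rw [D_eq_zero_of_V_eq_zero hV.symm, ← hV]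
    simp
  by_cases hM : R.M = ⊤
  · refine (min_le_right _ _).trans ?_
    rw [ratioFV, if_pos (R.F_eq_top_iff.2 hM)]
    exact V_le_D
  have hz := R.integral_sqrt_sub_M_neg hM hV
  have hFz := R.integral_sqrt_sub_sq √R.M.toReal
  have hX := R.integral_eq_of_shift √R.M.toReal
  have hle := R.ae_sqrt_le_M hM
  have hF := R.F_eq hM
  set a := √R.M.toReal
  have ha0 : 0 ≤ a := Real.sqrt_nonneg _
  set z := ∫ ω, (√(R.X ω) - a) ∂(R.P)
  set e := ∫ ω, (√(R.X ω) - a) ^ 2 ∂(R.P)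
  have he : 0 < e := by nlinarith
  have ha : 0 < a := by
    refine ha0.lt_of_ne fun h => ?_
    have : 0 ≤ z := integral_nonneg fun ω => by
      rw [← h, sub_zero]
      exact Real.sqrt_nonneg _
    linarith
  obtain ⟨hu, hgeo⟩ := geo_le_twoPoint ha hz he rfl rfl hle
  have hz0 : z ≠ 0 := hz.ne
  have hp : 0 < z ^ 2 / e := by positivity
  have hgap := le_twoPoint_gap (p := z ^ 2 / e) (u := e / (a * z)) hp
    ((div_le_one he).2 (by linarith)) hu
    (div_neg_of_pos_of_neg he (mul_neg_of_pos_of_neg ha hz)).le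
  have h1 := mul_le_mul_of_nonneg_left hgap (sq_nonneg a)
  have hVF : R.V = e - z ^ 2 := by linarith
  have e0 : ratioFV R.V R.F = e * R.V / (e - R.V) := by
    have : (e : EReal) ≠ (R.V : EReal) := by
      rw [Ne, EReal.coe_eq_coe_iff, hFz]
      have : z ^ 2 ≠ 0 := by positivity
      simpa using this
    rw [ratioFV, hF, if_neg (EReal.coe_ne_top _), if_neg this, EReal.toReal_coe]
  have e1 : a ^ 2 * ((e / (a * z)) ^ 2 * min (2 * (z ^ 2 / e) * (1 - z ^ 2 / e)) (1 - z ^ 2 / e)) =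
      min (2 * R.V) (ratioFV R.V R.F) := by
    rw [e0, ← mul_assoc, mul_min_of_nonneg _ _ (by positivity), hVF]
    congr 1
    · field_simp
    · rw [sub_sub_cancel]
      field_simp
  have e2 : a ^ 2 * (1 + 2 * (z ^ 2 / e) * (e / (a * z)) +
      z ^ 2 / e * (e / (a * z)) ^ 2) = ∫ ω, R.X ω ∂(R.P) := by
    rw [hX]
    field_simp
    ring
  rw [D_eq]
  rw [e1, mul_sub, e2] at h1
  linarith

end NonnegRV

/-! ### Two-point distributions and thinning -/

instance : DiscreteMeasurableSpace (ULift.{u} Bool) :=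
  ⟨fun s => MeasurableSet.of_discrete (s := ULift.up ⁻¹' s)⟩

/-- The Bernoulli distribution with mass `p` at `true`, on a two-point space in an arbitrary
universe. -/
noncomputable def bernoulliULift (p : ℝ) : Measure (ULift.{u} Bool) :=
  ENNReal.ofReal (1 - p) • Measure.dirac ⟨false⟩ + ENNReal.ofReal p • Measure.dirac ⟨true⟩

lemma isProbabilityMeasure_bernoulliULift {p : ℝ} (hp0 : 0 ≤ p) (hp1 : p ≤ 1) :
    IsProbabilityMeasure (bernoulliULift.{u} p) := by
  refine ⟨?_⟩
  simp only [bernoulliULift, Measure.add_apply, Measure.smul_apply, measure_univ, smul_eq_mul,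
    mul_one]
  rw [← ENNReal.ofReal_add (by linarith) hp0]
  simp

lemma integral_bernoulliULift {p : ℝ} (hp0 : 0 ≤ p) (hp1 : p ≤ 1) (f : ULift.{u} Bool → ℝ) :
    ∫ ω, f ω ∂(bernoulliULift p) = (1 - p) * f ⟨false⟩ + p * f ⟨true⟩ := by
  have := isProbabilityMeasure_bernoulliULift.{u} hp0 hp1
  rw [bernoulliULift, integral_add_measure, integral_smul_measure, integral_smul_measure,
    integral_dirac, integral_dirac, ENNReal.toReal_ofReal (by linarith), ENNReal.toReal_ofReal hp0]
  · rfl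
  · exact (integrable_dirac (by simp)).smul_measure ENNReal.ofReal_ne_top
  · exact (integrable_dirac (by simp)).smul_measure ENNReal.ofReal_ne_top

/-- The mixture of `P`, with weight `q`, and of a unit mass at an added point. -/
noncomputable def thinMeasure {Ω : Type u} [MeasurableSpace Ω] (P : Measure Ω) (q : ℝ) :
    Measure (Ω ⊕ PUnit.{u + 1}) :=
  ENNReal.ofReal q • P.map Sum.inl + ENNReal.ofReal (1 - q) • Measure.dirac (Sum.inr PUnit.unit)

section thinMeasure

variable {Ω : Type u} [MeasurableSpace Ω] {P : Measure Ω} {q : ℝ}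

lemma isProbabilityMeasure_thinMeasure (P : Measure Ω) [IsProbabilityMeasure P] (hq0 : 0 ≤ q)
    (hq1 : q ≤ 1) : IsProbabilityMeasure (thinMeasure P q) := by
  refine ⟨?_⟩
  rw [thinMeasure, Measure.add_apply, Measure.smul_apply, Measure.smul_apply,
    Measure.map_apply measurable_inl MeasurableSet.univ, preimage_univ, measure_univ, measure_univ,
    smul_eq_mul, smul_eq_mul, mul_one, mul_one, ← ENNReal.ofReal_add hq0 (by linarith)]
  simp

lemma integrable_thinMeasure {f : Ω ⊕ PUnit.{u + 1} → ℝ} (hf : Measurable f)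
    (hi : Integrable (fun ω => f (Sum.inl ω)) P) : Integrable f (thinMeasure P q) :=
  (((integrable_map_measure hf.aestronglyMeasurable measurable_inl.aemeasurable).2
    hi).smul_measure ENNReal.ofReal_ne_top).add_measure
    ((integrable_dirac' hf.stronglyMeasurable (by simp)).smul_measure ENNReal.ofReal_ne_top)

lemma integral_thinMeasure (hq0 : 0 ≤ q) (hq1 : q ≤ 1) {f : Ω ⊕ PUnit.{u + 1} → ℝ}
    (hf : Measurable f) (hi : Integrable (fun ω => f (Sum.inl ω)) P) :
    ∫ ω, f ω ∂(thinMeasure P q) =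
      q * (∫ ω, f (Sum.inl ω) ∂P) + (1 - q) * f (Sum.inr PUnit.unit) := by
  rw [thinMeasure, integral_add_measure, integral_smul_measure, integral_smul_measure,
    integral_dirac' _ _ hf.stronglyMeasurable,
    integral_map measurable_inl.aemeasurable hf.aestronglyMeasurable,
    ENNReal.toReal_ofReal hq0, ENNReal.toReal_ofReal (by linarith), smul_eq_mul, smul_eq_mul]
  · exact ((integrable_map_measure hf.aestronglyMeasurable measurable_inl.aemeasurable).2
      hi).smul_measure ENNReal.ofReal_ne_top
  · exact (integrable_dirac' hf.stronglyMeasurable (by simp)).smul_measure ENNReal.ofReal_ne_top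

lemma ae_thinMeasure (hq0 : 0 < q) (hq1 : q < 1) {C : Ω ⊕ PUnit.{u + 1} → Prop}
    (h : ∀ᵐ ω ∂(thinMeasure P q), C ω) :
    (∀ᵐ ω ∂P, C (Sum.inl ω)) ∧ C (Sum.inr PUnit.unit) := by
  rw [thinMeasure, ae_add_measure_iff] at h
  have h1 := (Measure.absolutelyContinuous_smul
    (ENNReal.ofReal_pos.2 hq0).ne' : P.map Sum.inl ≪ _).ae_le h.1
  have h2 := (Measure.absolutelyContinuous_smul (ENNReal.ofReal_pos.2 (sub_pos.2 hq1)).ne' :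
    Measure.dirac (Sum.inr PUnit.unit : Ω ⊕ PUnit.{u + 1}) ≪ _).ae_le h.2
  refine ⟨ae_of_ae_map measurable_inl.aemeasurable h1, ?_⟩
  by_contra hC
  exact (Measure.dirac_apply_of_mem (show (Sum.inr PUnit.unit : Ω ⊕ PUnit.{u + 1}) ∈ {ω | ¬C ω}
    from hC)).symm.trans h2 |> one_ne_zero

end thinMeasure

namespace NonnegRV

/-- The random variable with `√X = b` with probability `p`, and `√X = a` otherwise
(for `a, b ≥ 0`). -/
noncomputable def twoPoint (p a b : ℝ) (hp0 : 0 ≤ p) (hp1 : p ≤ 1) : NonnegRV.{u} where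
  Ω := ULift.{u} Bool
  P := bernoulliULift p
  isProb := isProbabilityMeasure_bernoulliULift hp0 hp1
  X := fun ω => if ω.down then b ^ 2 else a ^ 2
  measurable_X := Measurable.of_discrete
  nonneg_X := fun ω => by split_ifs <;> positivity
  integrable_X := by
    have := isProbabilityMeasure_bernoulliULift.{u} hp0 hp1
    exact Integrable.of_finite

section twoPoint

variable {p a b : ℝ} (hp0 : 0 < p) (hp1 : p < 1)

lemma twoPoint_atMostTwoValues : (twoPoint.{u} p a b hp0.le hp1.le).AtMostTwoValues := by
  have : range (twoPoint.{u} p a b hp0.le hp1.le).X ⊆ {a ^ 2, b ^ 2} := by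
    rintro _ ⟨⟨ω⟩, rfl⟩
    cases ω <;> simp [twoPoint]
  exact (encard_le_encard this).trans ((encard_insert_le _ _).trans (by rw [encard_singleton]; norm_num))

lemma integral_twoPoint (g : ℝ → ℝ) :
    ∫ ω, g ((twoPoint.{u} p a b hp0.le hp1.le).X ω) ∂(twoPoint.{u} p a b hp0.le hp1.le).P =
      (1 - p) * g (a ^ 2) + p * g (b ^ 2) := by
  refine (integral_bernoulliULift hp0.le hp1.le _).trans ?_
  simp [twoPoint]

lemma twoPoint_atom_left :
    (twoPoint.{u} p a b hp0.le hp1.le).P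
      {ω | (twoPoint.{u} p a b hp0.le hp1.le).X ω = a ^ 2} ≠ 0 := by
  intro h
  change bernoulliULift p {ω : ULift.{u} Bool | (if ω.down then b ^ 2 else a ^ 2) = a ^ 2} = 0 at h
  simp [bernoulliULift] at h
  linarith

lemma twoPoint_atom_right :
    (twoPoint.{u} p a b hp0.le hp1.le).P
      {ω | (twoPoint.{u} p a b hp0.le hp1.le).X ω = b ^ 2} ≠ 0 := by
  intro h
  change bernoulliULift p {ω : ULift.{u} Bool | (if ω.down then b ^ 2 else a ^ 2) = b ^ 2} = 0 at h
  simp [bernoulliULift] at h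
  linarith

lemma twoPoint_X_cases (ω : (twoPoint.{u} p a b hp0.le hp1.le).Ω) :
    (twoPoint.{u} p a b hp0.le hp1.le).X ω = a ^ 2 ∨
      (twoPoint.{u} p a b hp0.le hp1.le).X ω = b ^ 2 := by
  obtain ⟨ω⟩ := ω
  cases ω <;> simp [twoPoint]

lemma V_twoPoint (ha : 0 ≤ a) (hb : 0 ≤ b) :
    (twoPoint.{u} p a b hp0.le hp1.le).V = p * (1 - p) * (b - a) ^ 2 := by
  have h := (twoPoint.{u} p a b hp0.le hp1.le).integral_eq_V_add_sq
  rw [integral_twoPoint hp0 hp1 fun x => √x, integral_twoPoint hp0 hp1 fun x => x,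
    Real.sqrt_sq ha, Real.sqrt_sq hb] at h
  linear_combination -h

lemma E_twoPoint (ha : 0 ≤ a) (hb : 0 ≤ b) (hab : a ≤ b) :
    (twoPoint.{u} p a b hp0.le hp1.le).E = p * (b - a) ^ 2 := by
  have hm : (twoPoint.{u} p a b hp0.le hp1.le).m = a ^ 2 := by
    refine m_eq_of_atom (twoPoint_atom_left hp0 hp1) fun ω => ?_
    rcases twoPoint_X_cases hp0 hp1 ω with h | h <;> rw [h]
    gcongr
  rw [E, hm, integral_twoPoint hp0 hp1 fun x => (√x - √(a ^ 2)) ^ 2,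
    Real.sqrt_sq ha, Real.sqrt_sq hb]
  ring

lemma F_twoPoint (ha : 0 ≤ a) (hb : 0 ≤ b) (hab : b ≤ a) :
    (twoPoint.{u} p a b hp0.le hp1.le).F = ((p * (b - a) ^ 2 : ℝ) : EReal) := by
  have hm : (twoPoint.{u} p a b hp0.le hp1.le).M = ((a ^ 2 : ℝ) : EReal) := by
    refine M_eq_of_atom (twoPoint_atom_left hp0 hp1) fun ω => ?_
    rcases twoPoint_X_cases hp0 hp1 ω with h | h <;> rw [h]
    gcongr
  rw [F_eq _ (by rw [hm]; exact EReal.coe_ne_top _), hm, EReal.toReal_coe,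
    integral_twoPoint hp0 hp1 fun x => (√x - √(a ^ 2)) ^ 2, Real.sqrt_sq ha, Real.sqrt_sq hb]
  congr 1
  ring

lemma geo_twoPoint (ha : 0 ≤ a) (hb : 0 ≤ b) :
    (twoPoint.{u} p a b hp0.le hp1.le).geo = a ^ (2 * (1 - p)) * b ^ (2 * p) := by
  rcases ha.eq_or_lt with h | ha'
  · subst h
    rw [geo_eq_zero (by simpa using twoPoint_atom_left.{u} (a := 0) (b := b) hp0 hp1),
      Real.zero_rpow (by linarith), zero_mul]
  rcases hb.eq_or_lt with h | hb'
  · subst h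
    rw [geo_eq_zero (by simpa using twoPoint_atom_right.{u} (a := a) (b := 0) hp0 hp1),
      Real.zero_rpow (by linarith), mul_zero]
  have hI : Integrable (fun ω => Real.log ((twoPoint.{u} p a b hp0.le hp1.le).X ω))
      (twoPoint.{u} p a b hp0.le hp1.le).P := by
    have := isProbabilityMeasure_bernoulliULift.{u} hp0.le hp1.le
    exact Integrable.of_finite (μ := bernoulliULift.{u} p)
  have hval : Real.exp (∫ ω, Real.log ((twoPoint.{u} p a b hp0.le hp1.le).X ω)
      ∂(twoPoint.{u} p a b hp0.le hp1.le).P) = a ^ (2 * (1 - p)) * b ^ (2 * p) := by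
    rw [integral_twoPoint hp0 hp1 Real.log, Real.exp_add, Real.log_pow, Real.log_pow,
      Real.rpow_def_of_pos ha', Real.rpow_def_of_pos hb']
    congr 2 <;> (push_cast; ring)
  rw [← hval]
  refine le_antisymm (geo_le_exp_integral hI (.of_forall fun ω _ => le_rfl))
    (exp_integral_le_geo hI (.of_forall fun ω => ⟨?_, le_rfl⟩))
  rcases twoPoint_X_cases hp0 hp1 ω with h | h <;> rw [h] <;> positivity

lemma D_twoPoint (ha : 0 ≤ a) (hb : 0 ≤ b) :
    (twoPoint.{u} p a b hp0.le hp1.le).D =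
     
    (1 - p) * a ^ 2 + p * b ^ 2 - a ^ (2 * (1 - p)) * b ^ (2 * p) := by
  rw [D_eq, geo_twoPoint hp0 hp1 ha hb, integral_twoPoint hp0 hp1 fun x => x]

end twoPoint

open Filter Topology in
/-- When the two atoms of `√X` move off to infinity at a fixed distance `h`, the gap `D` tends to
`2 Var √X`. -/
lemma tendsto_twoPoint_gap {p h : ℝ} (hh : h ≠ 0) :
    Tendsto (fun a : ℝ => (1 - p) * a ^ 2 + p * (a + h) ^ 2 - a ^ (2 * (1 - p)) * (a + h) ^ (2 * p))
      atTop (𝓝 (2 * (p * (1 - p) * h ^ 2))) := by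
  have hu : Tendsto (fun a : ℝ => h / a) atTop (𝓝[≠] 0) := by
    refine tendsto_nhdsWithin_iff.2 ⟨tendsto_const_nhds.div_atTop tendsto_id, ?_⟩
    filter_upwards [eventually_gt_atTop 0] with a ha
    exact div_ne_zero hh ha.ne'
  have := ((tendsto_twoPoint_gap_div_sq p).comp hu).const_mul (h ^ 2)
  rw [show 2 * (p * (1 - p) * h ^ 2) = h ^ 2 * (2 * p * (1 - p)) by ring]
  refine this.congr' ?_
  filter_upwards [eventually_gt_atTop 0, eventually_gt_atTop (-h)] with a ha hah
  have h1 : a ^ (2 * (1 - p)) * (a + h) ^ (2 * p) = a ^ 2 * (1 + h / a) ^ (2 * p) := by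
    rw [show 1 + h / a = (a + h) / a by field_simp, Real.div_rpow (by linarith) ha.le,
      show 2 * (1 - p) = 2 - 2 * p by ring, Real.rpow_sub ha, Real.rpow_two]
    ring
  rw [h1]
  simp only [Function.comp]
  field_simp
  ring

/-- For `0 ≤ q ≤ 1`, the random variable that equals `s ^ 2 * X` with probability `q`, and `0`
otherwise. The zero value sits on an extra point added to the sample space. -/
noncomputable def thin (R : NonnegRV.{u}) (q s : ℝ) (hq0 : 0 ≤ q) (hq1 : q ≤ 1) :
    NonnegRV.{u} where
  Ω := R.Ω ⊕ PUnit.{u + 1}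
  P := thinMeasure R.P q
  isProb := isProbabilityMeasure_thinMeasure _ hq0 hq1
  X := Sum.elim (fun ω => s ^ 2 * R.X ω) fun _ => 0
  measurable_X := (R.measurable_X.const_mul _).sumElim measurable_const
  nonneg_X := by
    rintro (ω | ω)
    · exact mul_nonneg (sq_nonneg s) (R.nonneg_X ω)
    · exact le_rfl
  integrable_X := integrable_thinMeasure
    ((R.measurable_X.const_mul _).sumElim measurable_const) (R.integrable_X.const_mul _)

section thin

variable {R : NonnegRV.{u}} {q s : ℝ} (hq0 : 0 < q) (hq1 : q < 1)

lemma integral_thin {g : ℝ → ℝ} (hg : Measurable g) (h0 : g 0 = 0)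
    (hgX : Integrable (fun ω => g (s ^ 2 * R.X ω)) R.P) :
    ∫ ω, g ((R.thin q s hq0.le hq1.le).X ω) ∂(R.thin q s hq0.le hq1.le).P =
      q * ∫ ω, g (s ^ 2 * R.X ω) ∂(R.P) := by
  have h := integral_thinMeasure hq0.le hq1.le
    (hg.comp (R.thin q s hq0.le hq1.le).measurable_X) hgX
  refine h.trans ?_
  change q * (∫ ω, g (s ^ 2 * R.X ω) ∂(R.P)) + (1 - q) * g 0 = _
  rw [h0, mul_zero, add_zero]

lemma geo_thin : (R.thin q s hq0.le hq1.le).geo = 0 := by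
  refine geo_eq_zero fun h => ?_
  exact absurd (ae_thinMeasure hq0 hq1 (measure_eq_zero_iff_ae_notMem.1 h)).2 (not_not.2 rfl)

lemma D_thin : (R.thin q s hq0.le hq1.le).D = q * (s ^ 2 * ∫ ω, R.X ω ∂(R.P)) := by
  rw [D_eq, geo_thin hq0 hq1, sub_zero,
    integral_thin hq0 hq1 measurable_id' rfl (R.integrable_X.const_mul _), integral_const_mul]

lemma V_thin (hs : 0 < s) : (R.thin q s hq0.le hq1.le).V =
    q * (s ^ 2 * ∫ ω, R.X ω ∂(R.P)) - (q * (s * ∫ ω, √(R.X ω) ∂(R.P))) ^ 2 := by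
  have h := (R.thin q s hq0.le hq1.le).integral_eq_V_add_sq
  have hsq : ∀ ω, √(s ^ 2 * R.X ω) = s * √(R.X ω) := fun ω => by
    rw [Real.sqrt_mul (sq_nonneg s), Real.sqrt_sq hs.le]
  rw [integral_thin hq0 hq1 measurable_id' rfl (R.integrable_X.const_mul _), integral_const_mul,
    integral_thin hq0 hq1 (g := fun x => √x) (by fun_prop) Real.sqrt_zero
      (by simp_rw [hsq]; exact R.integrable_sqrt.const_mul _)] at h
  simp_rw [hsq] at h
  rw [integral_const_mul] at h
  linarith

lemma M_thin (hs : 0 < s) (hM : R.M = ⊤) : (R.thin q s hq0.le hq1.le).M = ⊤ := by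
  by_contra h
  have h1 := (R.thin q s hq0.le hq1.le).ae_le_M h
  set B := (R.thin q s hq0.le hq1.le).M.toReal
  have h3 := (ae_thinMeasure hq0 hq1 h1).1
  have h4 : R.M ≤ ((B / s ^ 2 : ℝ) : EReal) := by
    refine M_le_of_ae_le (h3.mono fun ω hω => ?_)
    rw [le_div_iff₀ (by positivity), mul_comm]
    exact hω
  rw [hM] at h4
  exact EReal.coe_ne_top _ (top_le_iff.1 h4)

end thin

end NonnegRV

/-! ### Sharpness -/

namespace NonnegRV

lemma supp_eq_singleton_of_V_eq_zero {R : NonnegRV.{u}} (h : R.V = 0) :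
    R.supp = {(∫ ω, √(R.X ω) ∂(R.P)) ^ 2} := by
  refine R.supp_nonempty.subset_singleton_iff.1 (R.supp_subset isClosed_singleton ?_)
  filter_upwards [ae_eq_const_of_V_eq_zero h] with ω hω
  rw [← hω, Real.sq_sqrt (R.nonneg_X ω)]
  rfl

lemma E_eq_zero_of_V_eq_zero {R : NonnegRV.{u}} (h : R.V = 0) : R.E = 0 := by
  rw [R.E_eq, h, m, supp_eq_singleton_of_V_eq_zero h, csInf_singleton, R.integral_sqrt_sub,
    Real.sqrt_sq (integral_nonneg fun ω => Real.sqrt_nonneg _)]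
  simp

lemma F_eq_zero_of_V_eq_zero {R : NonnegRV.{u}} (h : R.V = 0) : R.F = 0 := by
  have hM : R.M = (((∫ ω, √(R.X ω) ∂(R.P)) ^ 2 : ℝ) : EReal) := by
    rw [M, supp_eq_singleton_of_V_eq_zero h, iSup_singleton]
  rw [R.F_eq (by rw [hM]; exact EReal.coe_ne_top _), R.integral_sqrt_sub_sq, h, hM,
    EReal.toReal_coe, R.integral_sqrt_sub,
    Real.sqrt_sq (integral_nonneg fun ω => Real.sqrt_nonneg _)]
  simp

/-- In the two-point random variables with `V_X = V` and `E_X = E`, the atoms `a` and `a + h` of `√X`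
are at the distance `h = E / √(E - V)`, and `a ≥ 0` is arbitrary. -/
lemma max_le_of_forall_twoPoint {V E u : ℝ} (hV : 0 < V) (hVE : V < E)
    (hu : ∀ R ∈ XHi.{u} V E, R.AtMostTwoValues → R.D ≤ u) : max (2 * V) E ≤ u := by
  set d := √(E - V) with hd
  have hd0 : 0 < d := Real.sqrt_pos.2 (by linarith)
  have hE : 0 < E := by linarith
  have hd2 : E - V = d ^ 2 := (Real.sq_sqrt (by linarith)).symm
  set p := (E - V) / E with hp
  have hp0 : 0 < p := div_pos (by linarith) hE
  have hp1 : p < 1 := (div_lt_one hE).2 (by linarith)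
  have hh : 0 < E / d := div_pos hE hd0
  have hph : p * (E / d) ^ 2 = E := by
    rw [hp, hd2]
    field_simp
  have hVh : p * (1 - p) * (E / d) ^ 2 = V := by
    have : p * (1 - p) * (E / d) ^ 2 = (1 - p) * (p * (E / d) ^ 2) := by ring
    rw [this, hph, hp]
    field_simp
    ring
  have key : ∀ a : ℝ, 0 ≤ a → (1 - p) * a ^ 2 + p * (a + E / d) ^ 2 -
      a ^ (2 * (1 - p)) * (a + E / d) ^ (2 * p) ≤ u := by
    intro a ha
    have hb : 0 ≤ a + E / d := by linarith
    rw [← D_twoPoint.{u} hp0 hp1 ha hb]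
    refine hu _ ⟨?_, ?_⟩ (twoPoint_atMostTwoValues hp0 hp1)
    · rw [V_twoPoint hp0 hp1 ha hb, add_sub_cancel_left, hVh]
    · rw [E_twoPoint hp0 hp1 ha hb (by linarith), add_sub_cancel_left, hph]
  refine max_le ?_ ?_
  · have ht := tendsto_twoPoint_gap (p := p) hh.ne'
    rw [hVh] at ht
    exact le_of_tendsto ht ((Filter.eventually_ge_atTop 0).mono key)
  · have h0 := key 0 le_rfl
    rw [Real.zero_rpow (by linarith), zero_add, hph] at h0
    linarith

/-- In the two-point random variables with `V_X = V` and `F_X = F`, the atoms `b` and `b - h` of `√X`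
are at the distance `h = F / √(F - V)`, and `b ≥ h` is arbitrary. -/
lemma le_min_of_forall_twoPoint {V F u : ℝ} (hV : 0 < V) (hVF : V < F)
    (hu : ∀ R ∈ XLo.{u} V F, R.AtMostTwoValues → u ≤ R.D) :
    u ≤ min (2 * V) (F * V / (F - V)) := by
  set d := √(F - V) with hd
  have hd0 : 0 < d := Real.sqrt_pos.2 (by linarith)
  have hF : 0 < F := by linarith
  have hd2 : F - V = d ^ 2 := (Real.sq_sqrt (by linarith)).symm
  set p := (F - V) / F with hp
  have hp0 : 0 < p := div_pos (by linarith) hF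
  have hp1 : p < 1 := (div_lt_one hF).2 (by linarith)
  have hh : 0 < F / d := div_pos hF hd0
  have hph : p * (-(F / d)) ^ 2 = F := by
    rw [hp, hd2]
    field_simp
  have hVh : p * (1 - p) * (-(F / d)) ^ 2 = V := by
    have : p * (1 - p) * (-(F / d)) ^ 2 = (1 - p) * (p * (-(F / d)) ^ 2) := by ring
    rw [this, hph, hp]
    field_simp
    ring
  have key : ∀ b : ℝ, F / d ≤ b → u ≤ (1 - p) * b ^ 2 + p * (b + -(F / d)) ^ 2 -
      b ^ (2 * (1 - p)) * (b + -(F / d)) ^ (2 * p) := by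
    intro b hb
    have ha : 0 ≤ b + -(F / d) := by linarith
    rw [← D_twoPoint.{u} hp0 hp1 (hh.le.trans hb) ha]
    refine hu _ ⟨?_, ?_⟩ (twoPoint_atMostTwoValues hp0 hp1)
    · rw [V_twoPoint hp0 hp1 (hh.le.trans hb) ha, add_sub_cancel_left, hVh]
    · rw [F_twoPoint hp0 hp1 (hh.le.trans hb) ha (by linarith), add_sub_cancel_left, hph]
  refine le_min ?_ ?_
  · have ht := tendsto_twoPoint_gap (p := p) (neg_ne_zero.2 hh.ne')
    rw [hVh] at ht
    exact ge_of_tendsto ht ((Filter.eventually_ge_atTop (F / d)).mono key)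
  · have h0 := key (F / d) le_rfl
    rw [add_neg_cancel, Real.zero_rpow (by linarith)] at h0
    have h1 : (1 - p) * (F / d) ^ 2 = F * V / (F - V) := by
      have : 1 - p = V / F := by
        rw [hp]
        field_simp
        ring
      rw [this, hd2]
      field_simp
    linarith

open Filter Topology in
/-- Mixing an unbounded `X` with an atom at `0` whose weight tends to `1`, rescaled so as to keep
`V_X = V`, makes `E √X` tend to `0`, so that `D_X = V + (E √X)²` tends to `V`. -/
lemma le_V_of_forall_unbounded {V u : ℝ} {R : NonnegRV.{u}} (hR : R ∈ XLo.{u} V ⊤) (hV : 0 < V)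
    (hu : ∀ R ∈ XLo.{u} V ⊤, u ≤ R.D) : u ≤ V := by
  have hm := R.integral_eq_V_add_sq
  rw [hR.1] at hm
  set t₁ := ∫ ω, √(R.X ω) ∂(R.P) with ht₁
  set t₂ := ∫ ω, R.X ω ∂(R.P) with ht₂
  have ht₂0 : 0 < t₂ := by nlinarith [sq_nonneg t₁]
  have key : ∀ q : ℝ, 0 < q → q < 1 → u ≤ V * t₂ / (t₂ - q * t₁ ^ 2) := by
    intro q hq0 hq1
    have hden : 0 < t₂ - q * t₁ ^ 2 := by nlinarith [sq_nonneg t₁]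
    have hs : 0 < √(V / (q * (t₂ - q * t₁ ^ 2))) := Real.sqrt_pos.2 (by positivity)
    have hs2 := Real.sq_sqrt (by positivity : 0 ≤ V / (q * (t₂ - q * t₁ ^ 2)))
    refine (hu (R.thin q √(V / (q * (t₂ - q * t₁ ^ 2))) hq0.le hq1.le) ⟨?_, ?_⟩).trans_eq ?_
    · rw [V_thin hq0 hq1 hs, ← ht₁, ← ht₂, mul_pow, mul_pow, hs2]
      field_simp
    · rw [F_eq_top_iff]
      exact M_thin hq0 hq1 hs (R.F_eq_top_iff.1 hR.2)
    · rw [D_thin hq0 hq1, ← ht₂, hs2]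
      field_simp
  have hlim : Tendsto (fun q : ℝ => V * t₂ / (t₂ - q * t₁ ^ 2)) (𝓝[>] 0) (𝓝 V) := by
    have hc : ContinuousAt (fun q : ℝ => V * t₂ / (t₂ - q * t₁ ^ 2)) 0 :=
      ContinuousAt.div (by fun_prop) (by fun_prop) (by simpa using ht₂0.ne')
    have := hc.tendsto
    rw [zero_mul, sub_zero, mul_div_cancel_right₀ _ ht₂0.ne'] at this
    exact tendsto_nhdsWithin_of_tendsto_nhds this
  refine ge_of_tendsto hlim ?_
  filter_upwards [Ioo_mem_nhdsGT (zero_lt_one (α := ℝ))] with q hq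
  exact key q hq.1 hq.2

lemma exists_zero : ∃ R : NonnegRV.{u}, R.AtMostTwoValues ∧ R.V = 0 := by
  refine ⟨twoPoint (1 / 2) 0 0 (by norm_num) (by norm_num),
    twoPoint_atMostTwoValues (by norm_num) (by norm_num), ?_⟩
  rw [V_twoPoint (by norm_num) (by norm_num) le_rfl le_rfl]
  simp

lemma max_le_of_mem_upperBounds {V E u : ℝ} (hne : (XHi.{u} V E).Nonempty)
    (hu : ∀ R ∈ XHi.{u} V E, R.AtMostTwoValues → R.D ≤ u) : max (2 * V) E ≤ u := by
  obtain ⟨R, rfl, rfl⟩ := hne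
  rcases R.V_nonneg.eq_or_lt with hV | hV
  · obtain ⟨Z, hZ, hZV⟩ := exists_zero.{u}
    have hE := E_eq_zero_of_V_eq_zero hV.symm
    have := hu Z ⟨by rw [hZV, hV], by rw [hE, E_eq_zero_of_V_eq_zero hZV]⟩ hZ
    rw [D_eq_zero_of_V_eq_zero hZV] at this
    simpa [← hV, hE] using this
  · refine max_le_of_forall_twoPoint hV ?_ hu
    have := R.integral_sqrt_sub_m_pos hV
    rw [R.E_eq]
    nlinarith

lemma le_min_of_mem_lowerBounds {V u : ℝ} {F : EReal} (hne : (XLo.{u} V F).Nonempty) (hF : F ≠ ⊤)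
    (hu : ∀ R ∈ XLo.{u} V F, R.AtMostTwoValues → u ≤ R.D) :
    u ≤ min (2 * V) (ratioFV V F) := by
  obtain ⟨R, rfl, rfl⟩ := hne
  rcases R.V_nonneg.eq_or_lt with hV | hV
  · obtain ⟨Z, hZ, hZV⟩ := exists_zero.{u}
    have hF0 := F_eq_zero_of_V_eq_zero hV.symm
    have := hu Z ⟨by rw [hZV, hV], by rw [hF0, F_eq_zero_of_V_eq_zero hZV]⟩ hZ
    rw [D_eq_zero_of_V_eq_zero hZV] at this
    rw [hF0, ← hV, ratioFV]
    simpa using this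
  · have hM : R.M ≠ ⊤ := fun h => hF (R.F_eq_top_iff.2 h)
    have hFe := R.F_eq hM
    have hz := R.integral_sqrt_sub_M_neg hM hV
    rw [R.integral_sqrt_sub_sq] at hFe
    have hlt : R.V < R.V + (∫ ω, (√(R.X ω) - √R.M.toReal) ∂(R.P)) ^ 2 := by nlinarith
    rw [hFe] at hu ⊢
    rw [ratioFV, if_neg (EReal.coe_ne_top _), if_neg (by
      rw [EReal.coe_eq_coe_iff]
      exact hlt.ne'), EReal.toReal_coe]
    exact le_min_of_forall_twoPoint hV hlt hu

lemma le_min_of_mem_lowerBounds_top {V u : ℝ} (hne : (XLo.{u} V ⊤).Nonempty)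
    (hu : ∀ R ∈ XLo.{u} V ⊤, u ≤ R.D) : u ≤ min (2 * V) (ratioFV V ⊤) := by
  obtain ⟨R, hR⟩ := hne
  have hV : 0 < V := by
    refine lt_of_le_of_ne (hR.1 ▸ R.V_nonneg) fun h => ?_
    have := F_eq_zero_of_V_eq_zero (hR.1.trans h.symm)
    rw [hR.2] at this
    exact EReal.top_ne_zero this
  have := le_V_of_forall_unbounded hR hV hu
  rw [ratioFV, if_pos rfl]
  exact le_min (by linarith) this

end NonnegRV

theorem theorem1 :
    (∀ V E : ℝ, (XHi.{u} V E).Nonempty →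
      IsLUB (NonnegRV.D '' XHi.{u} V E) (max (2 * V) E) ∧
      IsLUB (NonnegRV.D '' {R ∈ XHi.{u} V E | R.AtMostTwoValues}) (max (2 * V) E)) ∧
    (∀ (V : ℝ) (F : EReal), (XLo.{u} V F).Nonempty →
      IsGLB (NonnegRV.D '' XLo.{u} V F) (min (2 * V) (ratioFV V F)) ∧
      (F ≠ ⊤ →
        IsGLB (NonnegRV.D '' {R ∈ XLo.{u} V F | R.AtMostTwoValues})
          (min (2 * V) (ratioFV V F)))) ∧
    (∀ R : NonnegRV.{u},
      min (2 * R.V) (ratioFV R.V R.F) ≤ R.D ∧ R.D ≤ max (2 * R.V) R.E) := by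
  refine ⟨fun V E hne => ?_, fun V F hne => ?_, fun R => ⟨R.le_D, R.D_le⟩⟩
  · have hub : ∀ R ∈ XHi.{u} V E, R.D ≤ max (2 * V) E := by
      rintro R ⟨rfl, rfl⟩
      exact R.D_le
    refine ⟨⟨forall_mem_image.2 hub, fun u hu => ?_⟩,
      ⟨forall_mem_image.2 fun R hR => hub R hR.1, fun u hu => ?_⟩⟩
    · exact NonnegRV.max_le_of_mem_upperBounds hne fun R hR _ => hu (mem_image_of_mem _ hR)
    · exact NonnegRV.max_le_of_mem_upperBounds hne fun R hR hR2 =>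
        hu (mem_image_of_mem _ ⟨hR, hR2⟩)
  · have hlb : ∀ R ∈ XLo.{u} V F, min (2 * V) (ratioFV V F) ≤ R.D := by
      rintro R ⟨rfl, rfl⟩
      exact R.le_D
    refine ⟨⟨forall_mem_image.2 hlb, fun u hu => ?_⟩, fun hF =>
      ⟨forall_mem_image.2 fun R hR => hlb R hR.1, fun u hu => ?_⟩⟩
    · by_cases hF : F = ⊤
      · subst hF
        exact NonnegRV.le_min_of_mem_lowerBounds_top hne fun R hR => hu (mem_image_of_mem _ hR)
      · exact NonnegRV.le_min_of_mem_lowerBounds hne hF fun R hR _ => hu (mem_image_of_mem _ hR)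
    · exact NonnegRV.le_min_of_mem_lowerBounds hne hF fun R hR hR2 =>
        hu (mem_image_of_mem _ ⟨hR, hR2⟩)
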